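/- Let $D$ be the open unit disk and $\partial/\partial\bar z=\tfrac12(\partial_x+i\partial_y)$. A function $g$ on $D$ has a boundary value in the sense of distributions $g_b\in\mathcal D'(\partial D)$ if $\langle g_b,\varphi\rangle=\lim_{r\nearrow1}\int_0^{2\pi}g(re^{i\theta})\varphi(\theta)\,d\theta$ for every $\varphi\in C^\infty(\partial D)$. Let $H_b$ be the set of holomorphic functions on $D$ with a boundary value in this sense, and $\operatorname{Re}\{(H^p(D))_b\}$ the set of real parts of the boundary values of functions in the Hardy space $H^p(D)$; for a distribution $u$, $\operatorname{Re}u=(u+\bar u)/2$ and $\operatorname{Im}u=(u-\bar u)/(2i)$ with $\langle\bar u,\varphi\rangle=\overline{\langle u,\bar\varphi\rangle}$. Put $$P_r(\theta)=\frac{1-r^2}{1-2r\cos\theta+r^2},\qquad Q_r(\theta)=\frac{2r\sin\theta}{1-2r\cos\theta+r^2}.$$ Let $n\ge1$, $h_k\in\operatorname{Re}\{(H^{p_k}(D))_b\}$ with $\frac12<p_k\le1$ for $1\le k\le n-1$, $h_0\in H_b$, and $c_k\in\mathbb R$ for $0\le k\le n-1$. Let $f$ be a solution in $D$ ($f$ of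 class $C^n$, with $\partial^kf/\partial\bar z^k$ having a boundary value in the sense of distributions for $0\le k\le n-1$) of $$\frac{\partial^nf}{\partial\bar z^n}=0,\quad \operatorname{Re}\Big\{\Big(\frac{\partial^kf}{\partial\bar z^k}\Big)_b\Big\}=h_k\ (1\le k\le n-1),\quad \operatorname{Re}\{f_b\}=\operatorname{Re}\{(h_0)_b\},\quad \operatorname{Im}\Big\{\frac{\partial^kf}{\partial\bar z^k}(0)\Big\}=c_k\ (0\le k\le n-1).$$ Let $h\in H_b$, $c\in\mathbb R$, and for $z=re^{i\theta}\in D$ let $$\begin{aligned}w(z)=\;&ic-I+\frac1{2\pi}\langle h_b,P_r(\theta-\cdot)\rangle+\bar z\Big(-\widetilde I+\frac1{2\pi}\langle(h_0)_b,P_r(\theta-\cdot)\rangle\Big)\\&-i\sum_{k=1}^n\sum_{\ell=k-1}^{n-1}\frac{(-1)^kc_\ell}{k!\,(\ell-k+1)!}\,\bar z^k(z+\bar z)^{\ell-k+1}\\&-\sum_{k=1}^n\ \sum_{\ell=\max(k-1,1)}^{n-1}\frac{(-1)^{\ell+1}}{2\pi\,k!\,(\ell-k+1)!}\,\bar z^k\Big\langle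 h_\ell,\big(P_r(\theta-\cdot)+iQ_r(\theta-\cdot)\big)\big(e^{i(\cdot)}-z+\overline{e^{i(\cdot)}-z}\big)^{\ell-k+1}\Big\rangle,\end{aligned}$$ where $I=\frac i{2\pi}\langle\operatorname{Im}h_b,1\rangle$ and $\widetilde I=\frac i{2\pi}\langle\operatorname{Im}(h_0)_b,1\rangle$. Then $w$ is smooth in $D$, $\partial w/\partial\bar z=f$ in $D$, the functions $\partial^kw/\partial\bar z^k$, $0\le k\le n$, have boundary values in the sense of distributions, and $w$ solves the Schwarz boundary value problem of order $n+1$ $$\begin{aligned}&\frac{\partial^{n+1}w}{\partial\bar z^{n+1}}=0\ \text{ in }D,\\&\operatorname{Re}\Big\{\Big(\frac{\partial^{k+1}w}{\partial\bar z^{k+1}}\Big)_b\Big\}=h_k\quad(1\le k\le n-1),\qquad \operatorname{Re}\Big\{\Big(\frac{\partial w}{\partial\bar z}\Big)_b\Big\}=\operatorname{Re}\{(h_0)_b\},\\&\operatorname{Re}\{w_b\}=\operatorname{Re}\Big\{h_b-\sum_{k=1}^n\frac{(-1)^k}{k!}e^{-ik(\cdot)}\Big(\frac{\partial^{k-1}f}{\partial\bar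 z^{k-1}}\Big)_b\Big\},\\&\operatorname{Im}\Big\{\frac{\partial^{k+1}w}{\partial\bar z^{k+1}}(0)\Big\}=c_k\quad(0\le k\le n-1),\qquad \operatorname{Im}\{w(0)\}=c.\end{aligned}$$ -/

import Mathlib

open Set Filter Topology
open scoped ContDiff

noncomputable section

namespace SchwarzDisk

/-! ### Test functions and distributions on the unit circle -/

/-- `C^∞(∂D)`: smooth complex functions on the unit circle, written as smooth `2π`-periodic
functions of the angle. -/
def CircleTest : StarSubalgebra ℂ (ℝ → ℂ) where
  carrier := {φ | ContDiff ℝ ∞ φ ∧ Function.Periodic φ (2 * Real.pi)}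
  mul_mem' := fun ha hb => ⟨ha.1.mul hb.1, ha.2.mul hb.2⟩
  add_mem' := fun ha hb => ⟨ha.1.add hb.1, ha.2.add hb.2⟩
  algebraMap_mem' := fun _ => ⟨contDiff_const, fun _ => rfl⟩
  star_mem' := fun {φ} ha =>
    ⟨Complex.conjCLE.contDiff.comp ha.1, fun t => congrArg star (ha.2 t)⟩

theorem mem_circleTest {φ : ℝ → ℂ} :
    φ ∈ CircleTest ↔ ContDiff ℝ ∞ φ ∧ Function.Periodic φ (2 * Real.pi) := Iff.rfl

/-- Continuity of a linear functional for the usual Fréchet topology of `C^∞(∂D)`: it is bounded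
by finitely many of the seminorms `sup |φ^(j)|`. -/
def IsCircleContinuous (u : CircleTest →ₗ[ℂ] ℂ) : Prop :=
  ∃ (N : ℕ) (C : ℝ), ∀ (φ : CircleTest) (M : ℝ),
    (∀ j ≤ N, ∀ t : ℝ, ‖iteratedDeriv j (φ : ℝ → ℂ) t‖ ≤ M) → ‖u φ‖ ≤ C * M

theorem IsCircleContinuous.nonneg_const {u : CircleTest →ₗ[ℂ] ℂ} (hu : IsCircleContinuous u) :
    ∃ (N : ℕ) (C : ℝ), 0 ≤ C ∧ ∀ (φ : CircleTest) (M : ℝ),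
      (∀ j ≤ N, ∀ t : ℝ, ‖iteratedDeriv j (φ : ℝ → ℂ) t‖ ≤ M) → ‖u φ‖ ≤ C * M := by
  obtain ⟨N, C, h⟩ := hu
  refine ⟨N, |C|, abs_nonneg C, fun φ M hM => (h φ M hM).trans ?_⟩
  have hM0 : 0 ≤ M := (norm_nonneg _).trans (hM 0 (Nat.zero_le _) 0)
  exact mul_le_mul_of_nonneg_right (le_abs_self C) hM0

/-- `𝒟'(∂D)`: the continuous linear functionals on `C^∞(∂D)`. -/
def CircleDistribution : Submodule ℂ (CircleTest →ₗ[ℂ] ℂ) where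
  carrier := {u | IsCircleContinuous u}
  zero_mem' := ⟨0, 0, fun _ M _ => by simp⟩
  add_mem' := by
    intro u v hu hv
    obtain ⟨N, C, hC⟩ := hu
    obtain ⟨N', C', hC'⟩ := hv
    refine ⟨max N N', C + C', fun φ M hM => ?_⟩
    have h1 := hC φ M fun j hj => hM j (hj.trans (le_max_left _ _))
    have h2 := hC' φ M fun j hj => hM j (hj.trans (le_max_right _ _))
    calc ‖(u + v) φ‖ ≤ ‖u φ‖ + ‖v φ‖ := norm_add_le _ _
      _ ≤ (C + C') * M := by linarith
  smul_mem' := by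
    intro a u hu
    obtain ⟨N, C, hC⟩ := hu
    refine ⟨N, ‖a‖ * C, fun φ M hM => ?_⟩
    have h1 := mul_le_mul_of_nonneg_left (hC φ M hM) (norm_nonneg a)
    simpa [mul_assoc] using h1

/-- The pairing `⟨u, φ⟩`, for a function `φ` of the angle that is a test function
(and `0` for other `φ`). -/
def pairing (u : CircleDistribution) (φ : ℝ → ℂ) : ℂ :=
  open Classical in if hφ : φ ∈ CircleTest then u.1 ⟨φ, hφ⟩ else 0

theorem pairing_coe (u : CircleDistribution) (φ : CircleTest) :
    pairing u (φ : ℝ → ℂ) = u.1 φ := by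
  simp [pairing]

/-- The conjugate distribution, `⟨ū, φ⟩ = conj ⟨u, conj φ⟩`. -/
def conjDist (u : CircleDistribution) : CircleDistribution where
  val :=
    { toFun := fun φ => star (u.1 (star φ))
      map_add' := fun φ ψ => by simp
      map_smul' := fun a φ => by simp }
  property := by
    obtain ⟨N, C, hC⟩ := u.2
    refine ⟨N, C, fun φ M hM => ?_⟩
    have key : ∀ j ≤ N, ∀ t : ℝ, ‖iteratedDeriv j ((star φ : CircleTest) : ℝ → ℂ) t‖ ≤ M := by
      intro j hj t
      have h1 : ((star φ : CircleTest) : ℝ → ℂ) = Complex.conjLIE ∘ (φ : ℝ → ℂ) := rfl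
      rw [h1, ← norm_iteratedFDeriv_eq_norm_iteratedDeriv,
        LinearIsometryEquiv.norm_iteratedFDeriv_comp_left,
        norm_iteratedFDeriv_eq_norm_iteratedDeriv]
      exact hM j hj t
    simpa using hC (star φ) M key

/-- The real part of a distribution. -/
def reDist (u : CircleDistribution) : CircleDistribution := (1 / 2 : ℂ) • (u + conjDist u)

/-- The imaginary part of a distribution. -/
def imDist (u : CircleDistribution) : CircleDistribution :=
  (1 / (2 * Complex.I) : ℂ) • (u - conjDist u)

theorem CircleTest.bounded_deriv (ψ : CircleTest) (j : ℕ) :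
    ∃ B : ℝ, ∀ t : ℝ, ‖iteratedDeriv j (ψ : ℝ → ℂ) t‖ ≤ B := by
  have hper : Function.Periodic (iteratedDeriv j (ψ : ℝ → ℂ)) (2 * Real.pi) := by
    intro t
    have h := iteratedDeriv_comp_add_const j (ψ : ℝ → ℂ) (2 * Real.pi)
    have h2 : (fun z => (ψ : ℝ → ℂ) (z + 2 * Real.pi)) = (ψ : ℝ → ℂ) := funext ψ.2.2
    rw [h2] at h
    exact (congrFun h t).symm
  have hcont : Continuous (iteratedDeriv j (ψ : ℝ → ℂ)) :=
    ψ.2.1.continuous_iteratedDeriv j (by exact_mod_cast le_top)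
  obtain ⟨B, hB⟩ := (isCompact_Icc (a := (0 : ℝ)) (b := 2 * Real.pi)).exists_bound_of_continuousOn
    hcont.continuousOn
  refine ⟨B, fun t => ?_⟩
  obtain ⟨s, hs, hst⟩ := hper.exists_mem_Ico₀ Real.two_pi_pos t
  rw [hst]
  exact hB s ⟨hs.1, hs.2.le⟩

/-- The product of a smooth function and a distribution, `⟨ψ u, φ⟩ = ⟨u, ψ φ⟩`. -/
def mulDist (ψ : CircleTest) (u : CircleDistribution) : CircleDistribution where
  val :=
    { toFun := fun φ => u.1 (ψ * φ)
      map_add' := fun φ φ' => by rw [mul_add, map_add]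
      map_smul' := fun a φ => by simp }
  property := by
    obtain ⟨N, C, hC0, hC⟩ := IsCircleContinuous.nonneg_const u.2
    choose B hB using CircleTest.bounded_deriv ψ
    have hB0 : ∀ j, 0 ≤ B j := fun j => (norm_nonneg _).trans (hB j 0)
    let K : ℝ := ∑ j ∈ Finset.range (N + 1), ∑ i ∈ Finset.range (j + 1), (j.choose i : ℝ) * B i
    refine ⟨N, C * K, fun φ M hM => ?_⟩
    have hM0 : 0 ≤ M := (norm_nonneg _).trans (hM 0 (Nat.zero_le _) 0)
    have key : ∀ j ≤ N, ∀ t : ℝ,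
        ‖iteratedDeriv j ((ψ * φ : CircleTest) : ℝ → ℂ) t‖ ≤ K * M := by
      intro j hj t
      have h1 := norm_iteratedFDeriv_mul_le (𝕜 := ℝ) ψ.2.1 φ.2.1 t (n := j)
        (by exact_mod_cast le_top)
      simp only [norm_iteratedFDeriv_eq_norm_iteratedDeriv] at h1
      refine h1.trans ?_
      calc ∑ i ∈ Finset.range (j + 1), (j.choose i : ℝ) * ‖iteratedDeriv i (ψ : ℝ → ℂ) t‖ *
              ‖iteratedDeriv (j - i) (φ : ℝ → ℂ) t‖
          ≤ ∑ i ∈ Finset.range (j + 1), (j.choose i : ℝ) * B i * M := by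
            refine Finset.sum_le_sum fun i _ => ?_
            have := hB i t
            have := hM (j - i) ((Nat.sub_le _ _).trans hj) t
            have := hB0 i
            gcongr
        _ = (∑ i ∈ Finset.range (j + 1), (j.choose i : ℝ) * B i) * M := by
            rw [Finset.sum_mul]
        _ ≤ K * M := by
            refine mul_le_mul_of_nonneg_right ?_ hM0
            refine Finset.single_le_sum
              (f := fun j => ∑ i ∈ Finset.range (j + 1), (j.choose i : ℝ) * B i)
              (fun j _ => Finset.sum_nonneg fun i _ => ?_) (Finset.mem_range.2 (by omega))
            have := hB0 i
            positivity
    have := hC (ψ * φ) (K * M) key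
    simpa [mul_assoc] using this

/-- The test function `θ ↦ e^{-ikθ}`. -/
def expTest (k : ℕ) : CircleTest :=
  ⟨fun t => Complex.exp (-(Complex.I * k * t)), by
    refine ⟨?_, fun t => ?_⟩
    · have h0 : ContDiff ℝ ∞ (fun t : ℝ => (t : ℂ)) := Complex.ofRealCLM.contDiff
      fun_prop
    · have h : -(Complex.I * k * ((t + 2 * Real.pi : ℝ) : ℂ))
          = -(Complex.I * k * t) - k * (2 * Real.pi * Complex.I) := by
        push_cast; ring
      simp only [h]
      exact Complex.exp_periodic.sub_nat_mul_eq k⟩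

/-! ### Boundary values in the sense of distributions -/

/-- `u ∈ 𝒟'(∂D)` is the boundary value of `f` in the sense of distributions:
`∫_0^{2π} f(re^{iθ}) φ(θ) dθ → ⟨u, φ⟩` as `r ↗ 1`, for every `φ ∈ C^∞(∂D)`. -/
def IsBoundaryValue (f : ℂ → ℂ) (u : CircleDistribution) : Prop :=
  ∀ φ : CircleTest,
    Tendsto (fun r : ℝ => ∫ θ in (0 : ℝ)..(2 * Real.pi),
        f (r * Complex.exp (Complex.I * θ)) * (φ : ℝ → ℂ) θ)
      (𝓝[<] 1) (𝓝 (pairing u φ))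

/-- `f` has a boundary value in the sense of distributions. -/
def HasBoundaryValue (f : ℂ → ℂ) : Prop := ∃ u, IsBoundaryValue f u

/-- The boundary value `f_b ∈ 𝒟'(∂D)` (and `0` if there is none). -/
def boundaryValue (f : ℂ → ℂ) : CircleDistribution :=
  open Classical in if h : HasBoundaryValue f then h.choose else 0

theorem IsBoundaryValue.unique {f : ℂ → ℂ} {u v : CircleDistribution}
    (hu : IsBoundaryValue f u) (hv : IsBoundaryValue f v) : u = v := by
  apply Subtype.ext
  apply LinearMap.ext
  intro φ
  rw [← pairing_coe, ← pairing_coe]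
  exact tendsto_nhds_unique (hu φ) (hv φ)

theorem IsBoundaryValue.boundaryValue_eq {f : ℂ → ℂ} {u : CircleDistribution}
    (hu : IsBoundaryValue f u) : boundaryValue f = u := by
  have h : HasBoundaryValue f := ⟨u, hu⟩
  rw [boundaryValue, dif_pos h]
  exact h.choose_spec.unique hu

/-- The open unit disk. -/
def unitDisk : Set ℂ := Metric.ball 0 1

/-- `H_b`: holomorphic functions on the disk with a boundary value in the sense of
distributions. -/
def Hb : Set (ℂ → ℂ) := {h | DifferentiableOn ℂ h unitDisk ∧ HasBoundaryValue h}

/-- The Hardy space `H^p(D)`. -/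
def HardySpace (p : ℝ) : Set (ℂ → ℂ) :=
  {g | DifferentiableOn ℂ g unitDisk ∧
    ∃ C : ℝ, ∀ r : ℝ, 0 ≤ r → r < 1 →
      ∫ θ in (0 : ℝ)..(2 * Real.pi), ‖g (r * Complex.exp (Complex.I * θ))‖ ^ p ≤ C}

/-- `Re{(H^p(D))_b}`: real parts of the boundary values of functions in `H^p(D)`. -/
def ReHardyBoundary (p : ℝ) : Set CircleDistribution :=
  {v | ∃ g ∈ HardySpace p, HasBoundaryValue g ∧ v = reDist (boundaryValue g)}

/-! ### The Cauchy-Riemann operator and the kernels -/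

/-- The Cauchy-Riemann operator `∂/∂z̄ = (∂/∂x + i ∂/∂y) / 2`. -/
def dbar (f : ℂ → ℂ) (z : ℂ) : ℂ :=
  (1 / 2) * (fderiv ℝ f z 1 + Complex.I * fderiv ℝ f z Complex.I)

/-- `P_r(θ) = (1 - r²) / (1 - 2 r cos θ + r²)`. -/
def poissonP (r θ : ℝ) : ℝ := (1 - r ^ 2) / (1 - 2 * r * Real.cos θ + r ^ 2)

/-- `Q_r(θ) = 2 r sin θ / (1 - 2 r cos θ + r²)`. -/
def poissonQ (r θ : ℝ) : ℝ := (2 * r * Real.sin θ) / (1 - 2 * r * Real.cos θ + r ^ 2)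

/-- `t ↦ P_r(θ - t)` for `z = r e^{iθ}`. -/
def kernelP (z : ℂ) (t : ℝ) : ℂ := (poissonP ‖z‖ (z.arg - t) : ℂ)

/-- `t ↦ (P_r(θ - t) + i Q_r(θ - t)) (e^{it} - z + conj (e^{it} - z))^m` for `z = r e^{iθ}`. -/
def kernelPQ (z : ℂ) (m : ℕ) (t : ℝ) : ℂ :=
  ((poissonP ‖z‖ (z.arg - t) : ℂ) + Complex.I * (poissonQ ‖z‖ (z.arg - t) : ℂ)) *
    ((Complex.exp (Complex.I * t) - z) + star (Complex.exp (Complex.I * t) - z)) ^ m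

theorem denom_ne_zero {r : ℝ} (h0 : 0 ≤ r) (h1 : r < 1) (θ : ℝ) :
    1 - 2 * r * Real.cos θ + r ^ 2 ≠ 0 := by
  have := Real.cos_le_one θ
  nlinarith [mul_nonneg h0 (sub_nonneg.2 this), mul_pos (sub_pos.2 h1) (sub_pos.2 h1)]

theorem kernelP_mem {z : ℂ} (hz : z ∈ unitDisk) : kernelP z ∈ CircleTest := by
  have hz1 : ‖z‖ < 1 := by simpa [unitDisk] using hz
  refine ⟨?_, fun t => ?_⟩
  · refine Complex.ofRealCLM.contDiff.comp (f := fun t : ℝ => poissonP ‖z‖ (z.arg - t)) ?_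
    unfold poissonP
    refine ContDiff.div (by fun_prop) (by fun_prop) fun t => denom_ne_zero (norm_nonneg _) hz1 _
  · simp only [kernelP, poissonP, ← sub_sub, Real.cos_sub_two_pi]

theorem kernelPQ_mem {z : ℂ} (hz : z ∈ unitDisk) (m : ℕ) : kernelPQ z m ∈ CircleTest := by
  have hz1 : ‖z‖ < 1 := by simpa [unitDisk] using hz
  have hQ : (fun t : ℝ => (poissonQ ‖z‖ (z.arg - t) : ℂ)) ∈ CircleTest := by
    refine ⟨?_, fun t => ?_⟩
    · refine Complex.ofRealCLM.contDiff.comp (f := fun t : ℝ => poissonQ ‖z‖ (z.arg - t)) ?_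
      unfold poissonQ
      refine ContDiff.div (by fun_prop) (by fun_prop) fun t => denom_ne_zero (norm_nonneg _) hz1 _
    · simp only [poissonQ, ← sub_sub, Real.cos_sub_two_pi, Real.sin_sub_two_pi]
  have hE : (fun t : ℝ => Complex.exp (Complex.I * t) - z) ∈ CircleTest := by
    have h0 : ContDiff ℝ ∞ (fun t : ℝ => (t : ℂ)) := Complex.ofRealCLM.contDiff
    refine ⟨by fun_prop, fun t => ?_⟩
    have h : Complex.I * ((t + 2 * Real.pi : ℝ) : ℂ)
        = Complex.I * t + 2 * Real.pi * Complex.I := by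
      push_cast; ring
    simp only [h, Complex.exp_periodic (Complex.I * t)]
  have hI : (fun _ : ℝ => Complex.I) ∈ CircleTest := ⟨contDiff_const, fun _ => rfl⟩
  exact mul_mem (add_mem (kernelP_mem hz) (mul_mem hI hQ)) (pow_mem (add_mem hE (star_mem hE)) m)

/-- `-I + (1/2π) ⟨h_b, P_r(θ - ·)⟩` with
`I = (i/2π) ⟨Im h_b, 1⟩`, at `z = r e^{iθ}`. -/
def poissonPart (h : ℂ → ℂ) (z : ℂ) : ℂ :=
  -(Complex.I / (2 * Real.pi) * pairing (imDist (boundaryValue h)) 1)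
    + 1 / (2 * Real.pi) * pairing (boundaryValue h) (kernelP z)

/-- The explicit solution `w`, for the data `h, h₀` (functions in `H_b`), `H ℓ` (distributions,
used for `1 ≤ ℓ ≤ n - 1`) and real numbers `c` and `cs ℓ` (used for `0 ≤ ℓ ≤ n - 1`). -/
def schwarzSolution (n : ℕ) (h h₀ : ℂ → ℂ) (H : ℕ → CircleDistribution) (c : ℝ) (cs : ℕ → ℝ)
    (z : ℂ) : ℂ :=
  Complex.I * c + poissonPart h z + star z * poissonPart h₀ z
    - Complex.I * ∑ k ∈ Finset.Icc 1 n, ∑ l ∈ Finset.Icc (k - 1) (n - 1),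
        (-1) ^ k * (cs l : ℂ) / (k.factorial * (l - (k - 1)).factorial)
          * star z ^ k * (z + star z) ^ (l - (k - 1))
    - ∑ k ∈ Finset.Icc 1 n, ∑ l ∈ Finset.Icc (max (k - 1) 1) (n - 1),
        (-1) ^ (l + 1) / (2 * Real.pi * k.factorial * (l - (k - 1)).factorial)
          * star z ^ k * pairing (H l) (kernelPQ z (l - (k - 1)))

end SchwarzDisk

end

namespace SchwarzDisk

/-! ### Calculus of the Cauchy-Riemann operator -/

/-! Write F_j for the j-th ∂/∂z̄-derivative of f, so that F_n = 0 on the disk. For real a, the sum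
G_a = ∑_j (-1)^j/j! (z + z̄ - a)^j F_j is holomorphic: ∂(z + z̄ - a)/∂z̄ = 1, so its
∂/∂z̄-derivative telescopes to the F_n term (`dbar_sum_mul`, `differentiableOn_holoPart`). Its
coefficients are real, so Re (G_a)_b and Im G_a(0) depend only on the Re (F_j)_b and the Im F_j(0).
The Schwarz formula for distributional boundary values (`IsBoundaryValue.reDist_schwarzKernel`)
recovers G_a from these data. At a point z with z + z̄ = a only the term j = 0 survives and G_a(z) =
f(z), so f is expressed through its data (`schwarz_representation`).

The same holds for the chain starting at F_k. Inserting these formulas identifies the double sums in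
w: on the disk, w = h + i(c - Im h(0)) - ∑_{k=1}^n (-1)^k/k! z̄^k F_{k-1} (`schwarzSolution_eq`). In
this closed form a second telescoping gives ∂w/∂z̄ = f, which settles every condition on the higher
derivatives. The boundary value of w is read off termwise since z̄^k tends to e^{-ikθ}, and the
imaginary constant does not contribute to Re w_b. -/

theorem isOpen_unitDisk : IsOpen unitDisk := Metric.isOpen_ball

theorem zero_mem_unitDisk : (0 : ℂ) ∈ unitDisk := by simp [unitDisk]

theorem dbar_congr {f g : ℂ → ℂ} (hfg : EqOn f g unitDisk) : EqOn (dbar f) (dbar g) unitDisk := by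
  intro z hz
  have h : f =ᶠ[𝓝 z] g := hfg.eventuallyEq_of_mem (isOpen_unitDisk.mem_nhds hz)
  simp only [dbar, h.fderiv_eq]

/-- The operator is local and the disk is open, so identities known only on the disk survive
differentiation there; values outside never matter. -/
theorem dbar_iterate_congr {f g : ℂ → ℂ} (hfg : EqOn f g unitDisk) (k : ℕ) :
    EqOn (dbar^[k] f) (dbar^[k] g) unitDisk := by
  induction k with
  | zero => exact hfg
  | succ k ih =>
    simp only [Function.iterate_succ_apply']
    exact dbar_congr ih

theorem dbar_const (a z : ℂ) : dbar (fun _ => a) z = 0 := by simp [dbar]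

theorem dbar_add {f g : ℂ → ℂ} {z : ℂ} (hf : DifferentiableAt ℝ f z)
    (hg : DifferentiableAt ℝ g z) : dbar (fun x => f x + g x) z = dbar f z + dbar g z := by
  simp only [dbar, fderiv_fun_add hf hg, add_apply]
  ring

theorem dbar_sub {f g : ℂ → ℂ} {z : ℂ} (hf : DifferentiableAt ℝ f z)
    (hg : DifferentiableAt ℝ g z) : dbar (fun x => f x - g x) z = dbar f z - dbar g z := by
  simp only [dbar, fderiv_fun_sub hf hg, sub_apply]
  ring

theorem dbar_mul {f g : ℂ → ℂ} {z : ℂ} (hf : DifferentiableAt ℝ f z)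
    (hg : DifferentiableAt ℝ g z) :
    dbar (fun x => f x * g x) z = dbar f z * g z + f z * dbar g z := by
  simp only [dbar, fderiv_fun_mul hf hg, add_apply,
    smul_apply, smul_eq_mul]
  ring

theorem dbar_pow {f : ℂ → ℂ} {z : ℂ} (hf : DifferentiableAt ℝ f z) (m : ℕ) :
    dbar (fun x => f x ^ (m + 1)) z = (m + 1) * f z ^ m * dbar f z := by
  induction m with
  | zero => simp
  | succ m ih =>
    have h : (fun x => f x ^ (m + 1 + 1)) = fun x => f x ^ (m + 1) * f x :=
      funext fun x => pow_succ _ _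
    rw [h, dbar_mul (hf.fun_pow _) hf, ih]
    push_cast
    ring

theorem dbar_of_differentiableAt {g : ℂ → ℂ} {z : ℂ} (hg : DifferentiableAt ℂ g z) :
    dbar g z = 0 := by
  have h := hg.fderiv_restrictScalars ℝ
  have h2 : fderiv ℂ g z Complex.I = Complex.I * fderiv ℂ g z 1 := by
    rw [← smul_eq_mul, ← (fderiv ℂ g z).map_smul, smul_eq_mul, mul_one]
  simp only [dbar, h, ContinuousLinearMap.coe_restrictScalars', h2]
  linear_combination (1 / 2 * fderiv ℂ g z 1) * Complex.I_mul_I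

theorem differentiableAt_of_dbar_eq_zero {g : ℂ → ℂ} {z : ℂ} (hg : DifferentiableAt ℝ g z)
    (h : dbar g z = 0) : DifferentiableAt ℂ g z := by
  refine differentiableAt_complex_iff_differentiableAt_real.2 ⟨hg, ?_⟩
  simp only [dbar] at h
  rw [smul_eq_mul]
  linear_combination (-2 * Complex.I) * h + fderiv ℝ g z Complex.I * Complex.I_mul_I

theorem dbar_star (z : ℂ) : dbar (fun x => star x) z = 1 := by
  have h : fderiv ℝ (fun x : ℂ => star x) z = Complex.conjCLE.toContinuousLinearMap :=
    Complex.conjCLE.toContinuousLinearMap.fderiv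
  simp only [dbar, h]
  simp
  norm_num

theorem contDiff_star {m : WithTop ℕ∞} : ContDiff ℝ m (fun x : ℂ => star x) :=
  Complex.conjCLE.contDiff

theorem contDiffOn_dbar {f : ℂ → ℂ} {m : ℕ} (hf : ContDiffOn ℝ (m + 1 : ℕ) f unitDisk) :
    ContDiffOn ℝ m (dbar f) unitDisk := by
  have h : ContDiffOn ℝ m (fderiv ℝ f) unitDisk :=
    hf.fderiv_of_isOpen isOpen_unitDisk (by norm_cast)
  have h1 := h.clm_apply (contDiffOn_const (c := (1 : ℂ)))
  have h2 := h.clm_apply (contDiffOn_const (c := Complex.I))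
  exact contDiffOn_const.mul (h1.add (contDiffOn_const.mul h2))

theorem contDiffOn_dbar_iterate {f : ℂ → ℂ} {m : ℕ} (k : ℕ)
    (hf : ContDiffOn ℝ (m + k : ℕ) f unitDisk) : ContDiffOn ℝ m (dbar^[k] f) unitDisk := by
  induction k generalizing m with
  | zero => exact hf
  | succ k ih =>
    rw [Function.iterate_succ_apply']
    exact contDiffOn_dbar (ih (by rwa [add_right_comm, add_assoc]))

/-- Telescoping: if `∂a_{j+1}/∂z̄ = -a_j` and `∂F_j/∂z̄ = F_{j+1}` at `z`, then
`∂(∑_{j<N} a_{j+1} F_j)/∂z̄ = a_N F_N - a_0 F_0` at `z`. -/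
theorem dbar_sum_mul {a F : ℕ → ℂ → ℂ} {z : ℂ} (N : ℕ)
    (ha : ∀ j, DifferentiableAt ℝ (a j) z) (ha' : ∀ j, dbar (a (j + 1)) z = -a j z)
    (hF : ∀ j < N, DifferentiableAt ℝ (F j) z) (hF' : ∀ j < N, dbar (F j) z = F (j + 1) z) :
    DifferentiableAt ℝ (fun x => ∑ j ∈ Finset.range N, a (j + 1) x * F j x) z ∧
    dbar (fun x => ∑ j ∈ Finset.range N, a (j + 1) x * F j x) z
      = a N z * F N z - a 0 z * F 0 z := by
  induction N with
  | zero => simp [dbar_const]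
  | succ N ih =>
    obtain ⟨h1, h2⟩ := ih (fun j hj => hF j (by omega)) (fun j hj => hF' j (by omega))
    have h3 := (ha (N + 1)).fun_mul (hF N (by omega))
    simp only [Finset.sum_range_succ]
    refine ⟨h1.fun_add h3, ?_⟩
    rw [dbar_add h1 h3, h2, dbar_mul (ha _) (hF N (by omega)), ha', hF' N (by omega)]
    ring

/-! ### The Schwarz kernel -/

theorem coe_mul (φ ψ : CircleTest) : ((φ * ψ : CircleTest) : ℝ → ℂ) = (φ : ℝ → ℂ) * ψ := rfl

theorem norm_exp_I_mul (t : ℝ) : ‖Complex.exp (Complex.I * t)‖ = 1 := by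
  rw [mul_comm]; exact Complex.norm_exp_ofReal_mul_I t

/-- With ζ = e^{it}, both sides equal (ζ + z)/(ζ - z). The right-hand form isolates the Cauchy
kernel. -/
theorem poisson_add_conjugate {z : ℂ} (hz : ‖z‖ < 1) (t : ℝ) :
    (poissonP ‖z‖ (z.arg - t) : ℂ) + Complex.I * (poissonQ ‖z‖ (z.arg - t) : ℂ)
      = 2 * (Complex.exp (Complex.I * t) / (Complex.exp (Complex.I * t) - z)) - 1 := by
  have hζ : Complex.exp (Complex.I * t) - z ≠ 0 := by
    intro h
    have := norm_exp_I_mul t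
    rw [sub_eq_zero.1 h] at this
    linarith
  -- Polar form of z relative to ζ = e^{it}: z = ζ r e^{i(arg z - t)}.
  have hz' : z = Complex.exp (Complex.I * t) *
      (‖z‖ * (Real.cos (z.arg - t) + Real.sin (z.arg - t) * Complex.I)) := by
    conv_lhs => rw [← Complex.norm_mul_exp_arg_mul_I z]
    rw [Complex.ofReal_cos, Complex.ofReal_sin, ← Complex.exp_mul_I, mul_left_comm,
      ← Complex.exp_add]
    congr 2
    push_cast
    ring
  have hd : ((1 - 2 * ‖z‖ * Real.cos (z.arg - t) + ‖z‖ ^ 2 : ℝ) : ℂ) ≠ 0 :=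
    Complex.ofReal_ne_zero.2 (denom_ne_zero (norm_nonneg z) hz _)
  have hcs : ((Real.cos (z.arg - t) : ℂ)) ^ 2 + (Real.sin (z.arg - t) : ℂ) ^ 2 = 1 := by
    exact_mod_cast Real.cos_sq_add_sin_sq (z.arg - t)
  unfold poissonP poissonQ
  rw [Complex.ofReal_div, Complex.ofReal_div]
  push_cast at hd ⊢
  set r : ℂ := (‖z‖ : ℂ)
  set e := Complex.exp (Complex.I * t)
  rw [← Complex.ofReal_sub, ← Complex.ofReal_cos, ← Complex.ofReal_sin] at *
  set co : ℂ := (Real.cos (z.arg - t) : ℂ)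
  set si : ℂ := (Real.sin (z.arg - t) : ℂ)
  obtain ⟨d, hd'⟩ : ∃ d, d = 1 - 2 * r * co + r ^ 2 := ⟨_, rfl⟩
  rw [← hd'] at hd ⊢
  field_simp
  rw [hd']
  rw [show (e - z) = e * (1 - r * (co + si * Complex.I)) by linear_combination -hz',
    show 2 * e - e * (1 - r * (co + si * Complex.I))
      = e * (1 + r * (co + si * Complex.I)) by ring]
  linear_combination (2 * e * r ^ 2) * hcs - 2 * e * r ^ 2 * si ^ 2 * Complex.I_sq

/-- The Schwarz kernel `t ↦ P_r(θ - t) + i Q_r(θ - t)`, `z = r e^{iθ}`. -/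
noncomputable def schwarzKernel (z : ℂ) (hz : z ∈ unitDisk) : CircleTest :=
  ⟨kernelPQ z 0, kernelPQ_mem hz 0⟩

theorem schwarzKernel_apply {z : ℂ} (hz : z ∈ unitDisk) (t : ℝ) :
    (schwarzKernel z hz : ℝ → ℂ) t
      = 2 * (Complex.exp (Complex.I * t) / (Complex.exp (Complex.I * t) - z)) - 1 := by
  rw [← poisson_add_conjugate (by simpa [unitDisk] using hz)]
  simp [schwarzKernel, kernelPQ]

/-- Reduces Poisson integrals to pairings with the Schwarz kernel and with its conjugate. -/
theorem kernelP_eq {z : ℂ} (hz : z ∈ unitDisk) :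
    kernelP z = (((1 / 2 : ℂ) • (schwarzKernel z hz + star (schwarzKernel z hz)) : CircleTest)
      : ℝ → ℂ) := by
  funext t
  change _ = (1 / 2 : ℂ) * (kernelPQ z 0 t + star (kernelPQ z 0 t))
  simp [kernelPQ, kernelP]
  ring

/-! ### Integral formulas on circles -/

theorem mul_mem_unitDisk {r : ℝ} (hr : r ∈ Ioo (0 : ℝ) 1) {z : ℂ} (hz : ‖z‖ ≤ 1) :
    (r : ℂ) * z ∈ unitDisk := by
  have : ‖(r : ℂ) * z‖ = r * ‖z‖ := by simp [abs_of_pos hr.1]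
  simp only [unitDisk, mem_ball_zero_iff, this]
  nlinarith [hr.1, hr.2, norm_nonneg z]

/-- For r < 1 the dilate is holomorphic past the closed disk, so Cauchy's theorems apply on the unit
circle itself. -/
theorem diffContOnCl_dilate {g : ℂ → ℂ} (hg : DifferentiableOn ℂ g unitDisk) {r : ℝ}
    (hr : r ∈ Ioo (0 : ℝ) 1) : DiffContOnCl ℂ (fun ζ => g (r * ζ)) (Metric.ball 0 |(1 : ℝ)|) := by
  refine DifferentiableOn.diffContOnCl ?_
  refine hg.comp (t := unitDisk) (by fun_prop) fun ζ hζ => mul_mem_unitDisk hr ?_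
  simpa using Metric.closure_ball_subset_closedBall hζ

theorem circleAverage_zero_one (F : ℂ → ℂ) :
    ∫ θ in (0 : ℝ)..(2 * Real.pi), F (Complex.exp (Complex.I * θ))
      = 2 * Real.pi * Real.circleAverage F 0 1 := by
  have hpi : (Real.pi : ℂ) ≠ 0 := by exact_mod_cast Real.pi_ne_zero
  simp only [Real.circleAverage, circleMap, Complex.real_smul]
  push_cast
  simp only [zero_add, one_mul, mul_comm Complex.I]
  field_simp
  simp only [mul_comm Complex.I]

/-- Cauchy's formula for ζ ↦ g(rζ), with dθ = dζ/(iζ). The kernel does not depend on r, so it can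
serve as a fixed test function. -/
theorem integral_cauchy {g : ℂ → ℂ} (hg : DifferentiableOn ℂ g unitDisk) {r : ℝ}
    (hr : r ∈ Ioo (0 : ℝ) 1) {z : ℂ} (hz : z ∈ unitDisk) :
    ∫ θ in (0 : ℝ)..(2 * Real.pi), g (r * Complex.exp (Complex.I * θ)) *
        (Complex.exp (Complex.I * θ) / (Complex.exp (Complex.I * θ) - z))
      = 2 * Real.pi * g (r * z) := by
  have h := (diffContOnCl_dilate hg hr).circleAverage_smul_div (w := z)
    (by simpa [unitDisk] using hz)
  rw [← h, ← circleAverage_zero_one]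
  simp [mul_comm]

/-- On |ζ| = 1 the conjugate of ζ/(ζ - z) is 1/(1 - z̄ζ), which is holomorphic on the closed disk
and equals 1 at 0; the mean value property applies to the product. -/
theorem integral_mean {g : ℂ → ℂ} (hg : DifferentiableOn ℂ g unitDisk) {r : ℝ}
    (hr : r ∈ Ioo (0 : ℝ) 1) {z : ℂ} (hz : z ∈ unitDisk) :
    ∫ θ in (0 : ℝ)..(2 * Real.pi), g (r * Complex.exp (Complex.I * θ)) *
        star (Complex.exp (Complex.I * θ) / (Complex.exp (Complex.I * θ) - z))
      = 2 * Real.pi * g 0 := by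
  have hz1 : ‖z‖ < 1 := by simpa [unitDisk] using hz
  have hd : DifferentiableOn ℂ (fun ζ => 1 / (1 - star z * ζ))
      (closure (Metric.ball 0 |(1 : ℝ)|)) := by
    refine DifferentiableOn.div (by fun_prop) (by fun_prop) fun ζ hζ h => ?_
    have h1 : ‖ζ‖ ≤ 1 := by simpa using Metric.closure_ball_subset_closedBall hζ
    have h2 : ‖star z * ζ‖ = 1 := by rw [← sub_eq_zero.1 h]; simp
    rw [norm_mul, norm_star] at h2
    nlinarith [norm_nonneg z, norm_nonneg ζ]
  have h := ((diffContOnCl_dilate hg hr).smul hd.diffContOnCl).circleAverage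
  simp only [mul_zero, sub_zero, div_one, smul_eq_mul, mul_one] at h
  rw [← h, ← circleAverage_zero_one]
  refine intervalIntegral.integral_congr fun θ _ => ?_
  congr 1
  have h1 : Complex.exp (Complex.I * θ) * star (Complex.exp (Complex.I * θ)) = 1 := by
    have := Complex.mul_conj (Complex.exp (Complex.I * θ))
    rw [Complex.normSq_eq_norm_sq, norm_exp_I_mul] at this
    simpa using this
  have h2 : star (Complex.exp (Complex.I * θ)) ≠ 0 := right_ne_zero_of_mul_eq_one h1
  rw [star_div₀, star_sub]
  have h3 : star (Complex.exp (Complex.I * θ)) - star z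
      = star (Complex.exp (Complex.I * θ)) * (1 - star z * Complex.exp (Complex.I * θ)) := by
    linear_combination star z * h1
  rw [h3, ← div_div, div_self h2]

/-! ### Boundary values of holomorphic functions -/

theorem eventually_mem_Ioo : ∀ᶠ r : ℝ in 𝓝[<] 1, r ∈ Ioo (0 : ℝ) 1 :=
  Ioo_mem_nhdsLT one_pos

theorem intervalIntegrable_boundary {g : ℂ → ℂ} (hg : ContinuousOn g unitDisk) {r : ℝ}
    (hr : r ∈ Ioo (0 : ℝ) 1) (φ : CircleTest) (a b : ℝ) :
    IntervalIntegrable (fun θ : ℝ => g (r * Complex.exp (Complex.I * θ)) * (φ : ℝ → ℂ) θ)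
      MeasureTheory.volume a b := by
  refine Continuous.intervalIntegrable (Continuous.mul ?_ φ.2.1.continuous) a b
  exact hg.comp_continuous (by fun_prop) fun t => mul_mem_unitDisk hr (norm_exp_I_mul t).le

theorem IsBoundaryValue.congr {f g : ℂ → ℂ} {u : CircleDistribution} (hf : IsBoundaryValue f u)
    (hfg : EqOn f g unitDisk) : IsBoundaryValue g u := by
  intro φ
  refine (hf φ).congr' ?_
  filter_upwards [eventually_mem_Ioo] with r hr
  refine intervalIntegral.integral_congr fun θ _ => ?_
  simp only [hfg (mul_mem_unitDisk hr (norm_exp_I_mul θ).le)]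

theorem HasBoundaryValue.isBoundaryValue {f : ℂ → ℂ} (hf : HasBoundaryValue f) :
    IsBoundaryValue f (boundaryValue f) := by
  obtain ⟨u, hu⟩ := hf
  rwa [hu.boundaryValue_eq]

theorem tendsto_dilate {g : ℂ → ℂ} (hg : ContinuousOn g unitDisk) {z : ℂ} (hz : z ∈ unitDisk) :
    Tendsto (fun r : ℝ => g (r * z)) (𝓝[<] 1) (𝓝 (g z)) := by
  have h1 : ContinuousAt g ((1 : ℝ) * z) := by
    simpa using hg.continuousAt (isOpen_unitDisk.mem_nhds hz)
  have h2 : ContinuousAt (fun r : ℝ => g (r * z)) 1 :=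
    ContinuousAt.comp (f := fun r : ℝ => (r : ℂ) * z) h1 (by fun_prop)
  simpa using h2.tendsto.mono_left nhdsWithin_le_nhds

theorem IsBoundaryValue.apply_one {g : ℂ → ℂ} (hg : DifferentiableOn ℂ g unitDisk)
    {u : CircleDistribution} (hu : IsBoundaryValue g u) : u.1 1 = 2 * Real.pi * g 0 := by
  have h0 : (0 : ℂ) ∈ unitDisk := by simp [unitDisk]
  rw [← pairing_coe]
  refine tendsto_nhds_unique (hu 1) (tendsto_const_nhds.congr' ?_)
  filter_upwards [eventually_mem_Ioo] with r hr
  have := integral_cauchy hg hr h0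
  simp only [sub_zero, mul_zero, div_self (Complex.exp_ne_zero _)] at this
  exact this.symm

/-- The Schwarz kernel is twice the Cauchy kernel minus 1, and Cauchy's formula on the dilates gives
g(rz) → g(z) as r → 1. -/
theorem IsBoundaryValue.apply_schwarzKernel {g : ℂ → ℂ} (hg : DifferentiableOn ℂ g unitDisk)
    {u : CircleDistribution} (hu : IsBoundaryValue g u) {z : ℂ} (hz : z ∈ unitDisk) :
    u.1 (schwarzKernel z hz) = 2 * Real.pi * (2 * g z - g 0) := by
  let φ : CircleTest := (1 / 2 : ℂ) • (schwarzKernel z hz + 1)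
  have hφ : ∀ t : ℝ, (φ : ℝ → ℂ) t
      = Complex.exp (Complex.I * t) / (Complex.exp (Complex.I * t) - z) := by
    intro t
    change (1 / 2 : ℂ) * ((schwarzKernel z hz : ℝ → ℂ) t + 1) = _
    rw [schwarzKernel_apply]
    ring
  have h1 : u.1 φ = 2 * Real.pi * g z := by
    rw [← pairing_coe]
    refine tendsto_nhds_unique (hu φ)
      (((tendsto_dilate hg.continuousOn hz).const_mul (2 * Real.pi : ℂ)).congr' ?_)
    filter_upwards [eventually_mem_Ioo] with r hr
    simp only [hφ, integral_cauchy hg hr hz]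
  have h2 : schwarzKernel z hz = (2 : ℂ) • φ - 1 := by simp [φ, smul_smul]
  rw [h2, map_sub, map_smul, h1, hu.apply_one hg, smul_eq_mul]
  ring

theorem IsBoundaryValue.apply_star_schwarzKernel {g : ℂ → ℂ} (hg : DifferentiableOn ℂ g unitDisk)
    {u : CircleDistribution} (hu : IsBoundaryValue g u) {z : ℂ} (hz : z ∈ unitDisk) :
    u.1 (star (schwarzKernel z hz)) = 2 * Real.pi * g 0 := by
  let φ : CircleTest := (1 / 2 : ℂ) • (star (schwarzKernel z hz) + 1)
  have hφ : ∀ t : ℝ, (φ : ℝ → ℂ) t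
      = star (Complex.exp (Complex.I * t) / (Complex.exp (Complex.I * t) - z)) := by
    intro t
    change (1 / 2 : ℂ) * (star ((schwarzKernel z hz : ℝ → ℂ) t) + 1) = _
    rw [schwarzKernel_apply]
    simp
  have h1 : u.1 φ = 2 * Real.pi * g 0 := by
    rw [← pairing_coe]
    refine tendsto_nhds_unique (hu φ) (tendsto_const_nhds.congr' ?_)
    filter_upwards [eventually_mem_Ioo] with r hr
    simp only [hφ, integral_mean hg hr hz]
  have h2 : star (schwarzKernel z hz) = (2 : ℂ) • φ - 1 := by simp [φ, smul_smul]
  rw [h2, map_sub, map_smul, h1, hu.apply_one hg, smul_eq_mul]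
  ring

theorem reDist_apply (u : CircleDistribution) (φ : CircleTest) :
    (reDist u).1 φ = 1 / 2 * (u.1 φ + star (u.1 (star φ))) := rfl

theorem imDist_apply (u : CircleDistribution) (φ : CircleTest) :
    (imDist u).1 φ = 1 / (2 * Complex.I) * (u.1 φ - star (u.1 (star φ))) := rfl

/-- The Schwarz formula. -/
theorem IsBoundaryValue.reDist_schwarzKernel {g : ℂ → ℂ} (hg : DifferentiableOn ℂ g unitDisk)
    {u : CircleDistribution} (hu : IsBoundaryValue g u) {z : ℂ} (hz : z ∈ unitDisk) :
    (reDist u).1 (schwarzKernel z hz) = 2 * Real.pi * (g z - Complex.I * (g 0).im) := by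
  rw [reDist_apply, hu.apply_schwarzKernel hg, hu.apply_star_schwarzKernel hg]
  have h := Complex.sub_conj (g 0)
  simp only [star_mul', RCLike.star_def, Complex.conj_ofReal, map_ofNat]
  push_cast at h
  linear_combination (-(Real.pi : ℂ)) * h

/-- Averaging the two kernel pairings 2π(2g(z) - g(0)) and 2πg(0) shows that the Poisson integral of
g_b is g; the subtracted term is i Im g(0). -/
theorem poissonPart_eq {g : ℂ → ℂ} (hg : g ∈ Hb) {z : ℂ} (hz : z ∈ unitDisk) :
    poissonPart g z = g z - Complex.I * (g 0).im := by
  have hu := hg.2.isBoundaryValue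
  have h1 : pairing (imDist (boundaryValue g)) 1 = 2 * Real.pi * (g 0).im := by
    change pairing _ ((1 : CircleTest) : ℝ → ℂ) = _
    rw [pairing_coe, imDist_apply, star_one, hu.apply_one hg.1]
    have h := Complex.sub_conj (g 0)
    have hI := Complex.I_ne_zero
    simp only [star_mul', RCLike.star_def, Complex.conj_ofReal, map_ofNat]
    push_cast at h
    field_simp
    linear_combination h
  have hpi : (Real.pi : ℂ) ≠ 0 := by exact_mod_cast Real.pi_ne_zero
  rw [poissonPart, h1, kernelP_eq hz, pairing_coe, map_smul, map_add,
    hu.apply_schwarzKernel hg.1, hu.apply_star_schwarzKernel hg.1, smul_eq_mul]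
  field_simp
  ring

/-! ### Operations on boundary values -/

theorem CircleDistribution.ext_apply {u v : CircleDistribution} (h : ∀ φ, u.1 φ = v.1 φ) :
    u = v :=
  Subtype.ext (LinearMap.ext h)

theorem mulDist_apply (ψ : CircleTest) (u : CircleDistribution) (φ : CircleTest) :
    (mulDist ψ u).1 φ = u.1 (ψ * φ) := rfl

theorem isBoundaryValue_iff {f : ℂ → ℂ} {u : CircleDistribution} :
    IsBoundaryValue f u ↔ ∀ φ : CircleTest,
      Tendsto (fun r : ℝ => ∫ θ in (0 : ℝ)..(2 * Real.pi),
        f (r * Complex.exp (Complex.I * θ)) * (φ : ℝ → ℂ) θ) (𝓝[<] 1) (𝓝 (u.1 φ)) := by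
  simp only [IsBoundaryValue, pairing_coe]

theorem IsBoundaryValue.zero : IsBoundaryValue (fun _ => 0) 0 := by
  rw [isBoundaryValue_iff]
  intro φ
  simp

theorem IsBoundaryValue.add {f g : ℂ → ℂ} {u v : CircleDistribution}
    (hf : ContinuousOn f unitDisk) (hg : ContinuousOn g unitDisk) (hu : IsBoundaryValue f u)
    (hv : IsBoundaryValue g v) : IsBoundaryValue (fun z => f z + g z) (u + v) := by
  rw [isBoundaryValue_iff] at *
  intro φ
  refine ((hu φ).add (hv φ)).congr' ?_
  filter_upwards [eventually_mem_Ioo] with r hr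
  rw [← intervalIntegral.integral_add (intervalIntegrable_boundary hf hr φ _ _)
    (intervalIntegrable_boundary hg hr φ _ _)]
  simp only [add_mul]

theorem IsBoundaryValue.const_mul {f : ℂ → ℂ} {u : CircleDistribution} (a : ℂ)
    (hu : IsBoundaryValue f u) : IsBoundaryValue (fun z => a * f z) (a • u) := by
  rw [isBoundaryValue_iff] at *
  intro φ
  simp only [mul_assoc, intervalIntegral.integral_const_mul]
  exact (hu φ).const_mul a

theorem IsBoundaryValue.sum {ι : Type*} {s : Finset ι} {g : ι → ℂ → ℂ}
    {u : ι → CircleDistribution} (hg : ∀ j ∈ s, ContinuousOn (g j) unitDisk)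
    (hu : ∀ j ∈ s, IsBoundaryValue (g j) (u j)) :
    IsBoundaryValue (fun z => ∑ j ∈ s, g j z) (∑ j ∈ s, u j) := by
  classical
  induction s using Finset.induction_on with
  | empty => simpa using IsBoundaryValue.zero
  | insert a s ha ih =>
    simp only [Finset.sum_insert ha]
    refine (hu a (Finset.mem_insert_self _ _)).add (hg a (Finset.mem_insert_self _ _)) ?_ ?_
    · exact continuousOn_finsetSum _ fun j hj => hg j (Finset.mem_insert_of_mem hj)
    · exact ih (fun j hj => hg j (Finset.mem_insert_of_mem hj))
        fun j hj => hu j (Finset.mem_insert_of_mem hj)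

/-- Integration over the circle, as a distribution. -/
noncomputable def circleMeasureDist : CircleDistribution where
  val :=
    { toFun := fun φ => ∫ θ in (0 : ℝ)..(2 * Real.pi), (φ : ℝ → ℂ) θ
      map_add' := fun φ ψ => intervalIntegral.integral_add
        (φ.2.1.continuous.intervalIntegrable _ _) (ψ.2.1.continuous.intervalIntegrable _ _)
      map_smul' := fun a φ => intervalIntegral.integral_const_mul a _ }
  property := by
    refine ⟨0, 2 * Real.pi, fun φ M hM => ?_⟩
    have h := intervalIntegral.norm_integral_le_of_norm_le_const (a := 0) (b := 2 * Real.pi)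
      (f := (φ : ℝ → ℂ)) (C := M) fun t _ => by simpa using hM 0 le_rfl t
    rw [sub_zero, abs_of_pos Real.two_pi_pos] at h
    exact h.trans_eq (mul_comm _ _)

theorem isBoundaryValue_const (a : ℂ) : IsBoundaryValue (fun _ => a) (a • circleMeasureDist) := by
  rw [isBoundaryValue_iff]
  intro φ
  simp only [intervalIntegral.integral_const_mul]
  exact tendsto_const_nhds

/-- Integration is a real distribution. This is why the constant adjusting Im w(0) leaves Re w_b
unchanged. -/
theorem reDist_smul_I_circleMeasureDist (t : ℝ) :
    reDist ((Complex.I * t : ℂ) • circleMeasureDist) = 0 := by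
  refine CircleDistribution.ext_apply fun φ => ?_
  have h : star (circleMeasureDist.1 (star φ)) = circleMeasureDist.1 φ := by
    have := intervalIntegral.intervalIntegral_conj (μ := MeasureTheory.volume) (a := 0)
      (b := 2 * Real.pi) (f := ((star φ : CircleTest) : ℝ → ℂ))
    refine this.symm.trans ?_
    change (∫ θ in (0 : ℝ)..(2 * Real.pi), star (star ((φ : ℝ → ℂ) θ))) = _
    simp only [star_star]
    rfl
  rw [reDist_apply]
  change 1 / 2 * (Complex.I * t * circleMeasureDist.1 φ
    + star (Complex.I * t * circleMeasureDist.1 (star φ))) = 0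
  rw [star_mul', h]
  simp

theorem reDist_add (u v : CircleDistribution) : reDist (u + v) = reDist u + reDist v := by
  refine CircleDistribution.ext_apply fun φ => ?_
  change _ = (reDist u).1 φ + (reDist v).1 φ
  simp only [reDist_apply, Submodule.coe_add, LinearMap.add_apply, star_add]
  ring

theorem reDist_real_smul (a : ℝ) (u : CircleDistribution) :
    reDist ((a : ℂ) • u) = (a : ℂ) • reDist u := by
  refine CircleDistribution.ext_apply fun φ => ?_
  change _ = (a : ℂ) * (reDist u).1 φ
  simp only [reDist_apply, Submodule.coe_smul, LinearMap.smul_apply, smul_eq_mul,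
    star_mul', RCLike.star_def, Complex.conj_ofReal]
  ring

theorem reDist_sum {ι : Type*} (s : Finset ι) (u : ι → CircleDistribution) :
    reDist (∑ j ∈ s, u j) = ∑ j ∈ s, reDist (u j) := by
  refine map_sum (AddMonoidHom.mk' reDist reDist_add) u s

/-- Only a real multiplier passes through the real part; it is needed for the powers of `reTest a`.
-/
theorem reDist_mulDist {ψ : CircleTest} (hψ : star ψ = ψ) (u : CircleDistribution) :
    reDist (mulDist ψ u) = mulDist ψ (reDist u) := by
  refine CircleDistribution.ext_apply fun φ => ?_
  simp only [reDist_apply, mulDist_apply, star_mul', hψ]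

theorem star_ofReal_mul_exp (r θ : ℝ) :
    star ((r : ℂ) * Complex.exp (Complex.I * θ)) = r * Complex.exp (-(Complex.I * θ)) := by
  simp [← Complex.exp_conj]

/-- On the circle of radius r, z̄^k = r^k e^{-ikθ}, and r^k → 1. -/
theorem IsBoundaryValue.star_pow_mul {f : ℂ → ℂ} {u : CircleDistribution} (k : ℕ)
    (hu : IsBoundaryValue f u) :
    IsBoundaryValue (fun z => star z ^ k * f z) (mulDist (expTest k) u) := by
  rw [isBoundaryValue_iff] at *
  intro φ
  have h1 : Tendsto (fun r : ℝ => (r : ℂ) ^ k) (𝓝[<] 1) (𝓝 1) := by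
    have : ContinuousAt (fun r : ℝ => (r : ℂ) ^ k) 1 := by fun_prop
    simpa using this.tendsto.mono_left nhdsWithin_le_nhds
  have h2 := h1.mul (hu (expTest k * φ))
  rw [one_mul] at h2
  refine h2.congr fun r => ?_
  rw [← intervalIntegral.integral_const_mul]
  refine intervalIntegral.integral_congr fun θ _ => ?_
  have h3 : star ((r : ℂ) * Complex.exp (Complex.I * θ)) ^ k
      = r ^ k * (expTest k : ℝ → ℂ) θ := by
    rw [star_ofReal_mul_exp, mul_pow, ← Complex.exp_nat_mul]
    simp only [expTest]
    congr 2
    ring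
  simp only [h3, coe_mul, Pi.mul_apply]
  ring

/-- The real test function `t ↦ e^{it} + e^{-it} - a`. -/
noncomputable def reTest (a : ℝ) : CircleTest := expTest 1 + star (expTest 1) - (a : ℂ) • 1

theorem reTest_apply (a t : ℝ) : (reTest a : ℝ → ℂ) t
    = Complex.exp (Complex.I * t) + star (Complex.exp (Complex.I * t)) - a := by
  change Complex.exp (-(Complex.I * (1 : ℕ) * t)) + star (Complex.exp (-(Complex.I * (1 : ℕ) * t)))
    - (a : ℂ) * 1 = _
  simp only [Nat.cast_one, mul_one, RCLike.star_def, ← Complex.exp_conj, map_neg, map_mul,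
    Complex.conj_I, Complex.conj_ofReal]
  ring_nf

theorem star_reTest (a : ℝ) : star (reTest a) = reTest a := by
  simp [reTest, add_comm]

/-- Taking a = z + z̄ turns ζ + ζ̄ - a into (ζ - z) plus its conjugate, the factor in `kernelPQ`. -/
theorem schwarzKernel_mul_reTest {z : ℂ} (hz : z ∈ unitDisk) {a : ℝ} (ha : (a : ℂ) = z + star z)
    (m : ℕ) : ((reTest a ^ m * schwarzKernel z hz : CircleTest) : ℝ → ℂ) = kernelPQ z m := by
  funext t
  change (reTest a : ℝ → ℂ) t ^ m * kernelPQ z 0 t = _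
  rw [reTest_apply, ha]
  simp only [kernelPQ, star_sub]
  ring

/-- On the circle of radius r the factor is 2r cos θ - a, so r multiplies only one of the two terms;
they are split and pass to the limit separately. -/
theorem IsBoundaryValue.re_sub_mul {f : ℂ → ℂ} {u : CircleDistribution}
    (hf : ContinuousOn f unitDisk) (hu : IsBoundaryValue f u) (a : ℝ) :
    IsBoundaryValue (fun z => (z + star z - a) * f z) (mulDist (reTest a) u) := by
  rw [isBoundaryValue_iff] at *
  intro φ
  have h1 : Tendsto (fun r : ℝ => (r : ℂ)) (𝓝[<] 1) (𝓝 1) := by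
    have : ContinuousAt (fun r : ℝ => (r : ℂ)) 1 := by fun_prop
    simpa using this.tendsto.mono_left nhdsWithin_le_nhds
  have h2 := (h1.mul (hu (reTest 0 * φ))).sub ((hu φ).const_mul (a : ℂ))
  have h3 : 1 * u.1 (reTest 0 * φ) - a * u.1 φ = (mulDist (reTest a) u).1 φ := by
    rw [mulDist_apply, one_mul, ← smul_eq_mul (a : ℂ), ← map_smul, ← map_sub]
    congr 1
    simp [reTest, sub_mul]
  rw [h3] at h2
  refine h2.congr' ?_
  filter_upwards [eventually_mem_Ioo] with r hr
  rw [← intervalIntegral.integral_const_mul, ← intervalIntegral.integral_const_mul,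
    ← intervalIntegral.integral_sub ((intervalIntegrable_boundary hf hr _ _ _).const_mul _)
      ((intervalIntegrable_boundary hf hr _ _ _).const_mul _)]
  refine intervalIntegral.integral_congr fun θ _ => ?_
  simp only [coe_mul, Pi.mul_apply, reTest_apply, star_mul', RCLike.star_def, Complex.conj_ofReal,
    Complex.ofReal_zero]
  ring

theorem IsBoundaryValue.re_sub_pow_mul {f : ℂ → ℂ} {u : CircleDistribution}
    (hf : ContinuousOn f unitDisk) (hu : IsBoundaryValue f u) (a : ℝ) (m : ℕ) :
    IsBoundaryValue (fun z => (z + star z - a) ^ m * f z) (mulDist (reTest a ^ m) u) := by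
  induction m with
  | zero =>
    have : mulDist (reTest a ^ 0) u = u := CircleDistribution.ext_apply fun φ => by
      simp [mulDist_apply]
    rw [this]
    simpa using hu
  | succ m ih =>
    have hc : ContinuousOn (fun z : ℂ => (z + star z - a) ^ m * f z) unitDisk :=
      ContinuousOn.mul (by fun_prop) hf
    have h := ih.re_sub_mul hc a
    have e1 : mulDist (reTest a) (mulDist (reTest a ^ m) u) = mulDist (reTest a ^ (m + 1)) u :=
      CircleDistribution.ext_apply fun φ => by simp only [mulDist_apply, pow_succ, mul_assoc]
    rw [e1] at h
    refine h.congr fun z _ => ?_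
    ring

/-! ### The Schwarz representation of polyanalytic functions -/

/-- `∑_{j<N} (a - (z + z̄))^j F_j(z) / j!`; it is holomorphic when `∂F_j/∂z̄ = F_{j+1}` and
`F_N = 0`. -/
noncomputable def holoPart (N : ℕ) (F : ℕ → ℂ → ℂ) (a : ℝ) (z : ℂ) : ℂ :=
  ∑ j ∈ Finset.range N, (-1) ^ j / (j.factorial : ℂ) * ((z + star z - a) ^ j * F j z)

theorem dbar_re_sub (a : ℝ) (z : ℂ) : dbar (fun x => x + star x - a) z = 1 := by
  have h1 : DifferentiableAt ℝ (fun x : ℂ => star x) z :=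
    (contDiff_star (m := 1)).differentiable (by norm_num) z
  rw [dbar_sub (by fun_prop) (by fun_prop), dbar_add (by fun_prop) h1, dbar_const, dbar_star,
    dbar_of_differentiableAt differentiableAt_fun_id]
  ring

/-- Since ∂(z + z̄ - a)/∂z̄ = 1, the coefficients (-1)^i/i! (z + z̄ - a)^i form a chain under
-∂/∂z̄, and the sum telescopes. -/
theorem differentiableOn_holoPart {N : ℕ} {F : ℕ → ℂ → ℂ}
    (hF : ∀ j < N, ContDiffOn ℝ 1 (F j) unitDisk)
    (hF' : ∀ j < N, ∀ z ∈ unitDisk, dbar (F j) z = F (j + 1) z)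
    (hN : ∀ z ∈ unitDisk, F N z = 0) (a : ℝ) : DifferentiableOn ℂ (holoPart N F a) unitDisk := by
  intro z hz
  have hstar : DifferentiableAt ℝ (fun x : ℂ => star x) z :=
    (contDiff_star (m := 1)).differentiable (by norm_num) z
  have hb : DifferentiableAt ℝ (fun x : ℂ => x + star x - a) z := by fun_prop
  -- Index shifted by one with `A 0 = 0`, so the lower end of the telescoping sum vanishes; the
  -- upper end vanishes because F_N = 0.
  let A : ℕ → ℂ → ℂ := fun j x =>
    Nat.casesOn j 0 fun i => (-1) ^ i / (i.factorial : ℂ) * (x + star x - a) ^ i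
  have hA : ∀ j, DifferentiableAt ℝ (A j) z := by
    rintro (_ | j)
    · exact differentiableAt_const (0 : ℂ)
    · exact (differentiableAt_const _).fun_mul (hb.fun_pow j)
  have hA' : ∀ j, dbar (A (j + 1)) z = -A j z := by
    rintro (_ | j)
    · change dbar (fun x : ℂ => (-1) ^ 0 / (Nat.factorial 0 : ℂ) * (x + star x - a) ^ 0) z = -0
      simp only [pow_zero, neg_zero]
      exact dbar_const _ _
    · change dbar (fun x : ℂ => (-1) ^ (j + 1) / ((j + 1).factorial : ℂ)
        * (x + star x - a) ^ (j + 1)) z = -((-1) ^ j / (j.factorial : ℂ) * (z + star z - a) ^ j)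
      rw [dbar_mul (differentiableAt_const _) (hb.fun_pow _), dbar_const, dbar_pow hb, dbar_re_sub,
        Nat.factorial_succ]
      have h1 : (j.factorial : ℂ) ≠ 0 := by exact_mod_cast j.factorial_ne_zero
      have h2 : (j : ℂ) + 1 ≠ 0 := by exact_mod_cast j.succ_ne_zero
      push_cast
      field_simp
      ring
  obtain ⟨h1, h2⟩ := dbar_sum_mul (F := F) N hA hA'
    (fun j hj => ((hF j hj).differentiableOn (by norm_num)).differentiableAt
      (isOpen_unitDisk.mem_nhds hz)) (fun j hj => hF' j hj z hz)
  have h3 : holoPart N F a = fun x => ∑ j ∈ Finset.range N, A (j + 1) x * F j x := by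
    funext x
    simp only [holoPart, A, mul_assoc]
  rw [h3]
  refine (differentiableAt_of_dbar_eq_zero h1 ?_).differentiableWithinAt
  rw [h2, hN z hz]
  simp [A]

/-- The shifted chain is smooth by induction, and F_0 is the holomorphic `holoPart` minus smooth
multiples of the later F_j. The choice a = 0 is immaterial. -/
theorem contDiffOn_of_dbar_chain {N : ℕ} {F : ℕ → ℂ → ℂ}
    (hF : ∀ j < N, ContDiffOn ℝ 1 (F j) unitDisk)
    (hF' : ∀ j < N, ∀ z ∈ unitDisk, dbar (F j) z = F (j + 1) z)
    (hN : ∀ z ∈ unitDisk, F N z = 0) : ∀ j < N, ContDiffOn ℝ ∞ (F j) unitDisk := by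
  induction N generalizing F with
  | zero => intro j hj; omega
  | succ N ih =>
    have ih' := ih (F := fun j => F (j + 1)) (fun j hj => hF _ (by omega))
      (fun j hj => hF' _ (by omega)) hN
    rintro (_ | j) hj
    · have h1 : ContDiffOn ℝ ∞ (holoPart (N + 1) F 0) unitDisk :=
        ((differentiableOn_holoPart hF hF' hN 0).contDiffOn isOpen_unitDisk).restrict_scalars ℝ
      have h2 : ContDiffOn ℝ ∞ (fun z => ∑ j ∈ Finset.range N,
          (-1) ^ (j + 1) / ((j + 1).factorial : ℂ) *
            ((z + star z - (0 : ℝ)) ^ (j + 1) * F (j + 1) z)) unitDisk := by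
        refine ContDiffOn.sum fun j hj => contDiffOn_const.mul (ContDiffOn.mul ?_
          (ih' j (Finset.mem_range.1 hj)))
        exact (((contDiff_id.add contDiff_star).sub contDiff_const).pow _).contDiffOn
      refine (h1.sub h2).congr fun z _ => ?_
      simp [holoPart, Finset.sum_range_succ']
    · exact ih' j (by omega)

theorem isBoundaryValue_holoPart {N : ℕ} {F : ℕ → ℂ → ℂ}
    (hF : ∀ j < N, ContDiffOn ℝ 1 (F j) unitDisk) (hbv : ∀ j < N, HasBoundaryValue (F j)) (a : ℝ) :
    IsBoundaryValue (holoPart N F a) (∑ j ∈ Finset.range N,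
      ((-1) ^ j / (j.factorial : ℂ)) • mulDist (reTest a ^ j) (boundaryValue (F j))) := by
  have hb : ContinuousOn (fun z : ℂ => z + star z - a) unitDisk := by fun_prop
  refine IsBoundaryValue.sum (fun j hj => ?_) fun j hj => ?_
  · exact continuousOn_const.mul ((hb.pow j).mul (hF j (Finset.mem_range.1 hj)).continuousOn)
  · exact (((hbv j (Finset.mem_range.1 hj)).isBoundaryValue).re_sub_pow_mul
      (hF j (Finset.mem_range.1 hj)).continuousOn a j).const_mul _

/-- Apply the Schwarz formula to `holoPart N F a`, with a depending on the evaluation point. -/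
theorem schwarz_representation {N : ℕ} (hN0 : 0 < N) {F : ℕ → ℂ → ℂ}
    (hF : ∀ j < N, ContDiffOn ℝ 1 (F j) unitDisk)
    (hF' : ∀ j < N, ∀ z ∈ unitDisk, dbar (F j) z = F (j + 1) z)
    (hN : ∀ z ∈ unitDisk, F N z = 0) (hbv : ∀ j < N, HasBoundaryValue (F j))
    {z : ℂ} (hz : z ∈ unitDisk) :
    F 0 z = Complex.I * ∑ j ∈ Finset.range N,
        ((F j 0).im : ℂ) / (j.factorial : ℂ) * (z + star z) ^ j
      + ∑ j ∈ Finset.range N, (-1) ^ j / (2 * Real.pi * j.factorial : ℂ)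
        * pairing (reDist (boundaryValue (F j))) (kernelPQ z j) := by
  -- This real a makes z' + z̄' - a vanish at z' = z, leaving only the term j = 0 there.
  obtain ⟨a, ha⟩ : ∃ a : ℝ, (a : ℂ) = z + star z := ⟨2 * z.re, (Complex.add_conj z).symm⟩
  have hpi : (Real.pi : ℂ) ≠ 0 := by exact_mod_cast Real.pi_ne_zero
  have hS := (isBoundaryValue_holoPart hF hbv a).reDist_schwarzKernel
    (differentiableOn_holoPart hF hF' hN a) hz
  have e1 : holoPart N F a z = F 0 z := by
    obtain ⟨M, rfl⟩ : ∃ M, N = M + 1 := ⟨N - 1, by omega⟩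
    simp [holoPart, ha, Finset.sum_range_succ']
  -- At the origin the factor is (-a)^j; its sign cancels (-1)^j, leaving the real coefficient
  -- a^j/j!.
  have e2 : ((holoPart N F a 0).im : ℂ) = ∑ j ∈ Finset.range N,
      ((F j 0).im : ℂ) / (j.factorial : ℂ) * (z + star z) ^ j := by
    rw [← ha, holoPart, Complex.im_sum]
    push_cast
    refine Finset.sum_congr rfl fun j _ => ?_
    have e3 : (-1) ^ j / (j.factorial : ℂ) * ((0 + star (0 : ℂ) - a) ^ j * F j 0)
        = ((a ^ j / j.factorial : ℝ) : ℂ) * F j 0 := by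
      have : (-1 : ℂ) ^ j * (-1) ^ j = 1 := by rw [← mul_pow]; simp
      rw [star_zero, zero_add, zero_sub, neg_pow (a : ℂ)]
      push_cast
      linear_combination (a : ℂ) ^ j * F j 0 / j.factorial * this
    rw [e3, Complex.im_ofReal_mul]
    push_cast
    ring
  -- All coefficients and multipliers are real, so the real part falls on each boundary value; the
  -- multiplier then moves onto the kernel.
  have e4 : (reDist (∑ j ∈ Finset.range N, ((-1) ^ j / (j.factorial : ℂ)) •
        mulDist (reTest a ^ j) (boundaryValue (F j)))).1 (schwarzKernel z hz)
      = ∑ j ∈ Finset.range N, (-1) ^ j / (j.factorial : ℂ) *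
          pairing (reDist (boundaryValue (F j))) (kernelPQ z j) := by
    rw [reDist_sum, Submodule.coe_sum, LinearMap.sum_apply]
    refine Finset.sum_congr rfl fun j _ => ?_
    have e5 : (-1) ^ j / (j.factorial : ℂ) = (((-1) ^ j / j.factorial : ℝ) : ℂ) := by push_cast; rfl
    rw [e5, reDist_real_smul, reDist_mulDist (by rw [star_pow, star_reTest]),
      ← schwarzKernel_mul_reTest hz ha, pairing_coe]
    rfl
  rw [e4, e1, e2] at hS
  have e6 : ∑ j ∈ Finset.range N, (-1) ^ j / (2 * Real.pi * j.factorial : ℂ)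
        * pairing (reDist (boundaryValue (F j))) (kernelPQ z j)
      = 1 / (2 * Real.pi) * ∑ j ∈ Finset.range N, (-1) ^ j / (j.factorial : ℂ) *
          pairing (reDist (boundaryValue (F j))) (kernelPQ z j) := by
    rw [Finset.mul_sum]
    refine Finset.sum_congr rfl fun j _ => ?_
    field_simp
  rw [e6, hS]
  field_simp
  ring

/-! ### The explicit solution -/

theorem sum_Icc_one_eq_sum_range {M : Type*} [AddCommMonoid M] (n : ℕ) (T : ℕ → M) :
    ∑ k ∈ Finset.Icc 1 n, T k = ∑ j ∈ Finset.range n, T (j + 1) := by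
  rw [← Finset.Ico_add_one_right_eq_Icc, Finset.sum_Ico_eq_sum_range]
  simp [add_comm]

theorem sum_Icc_eq_sum_range {M : Type*} [AddCommMonoid M] {n : ℕ} (hn : 1 ≤ n) (j : ℕ)
    (T : ℕ → M) :
    ∑ l ∈ Finset.Icc j (n - 1), T l = ∑ i ∈ Finset.range (n - j), T (j + i) := by
  rw [← Finset.Ico_add_one_right_eq_Icc, Nat.sub_add_cancel hn, Finset.sum_Ico_eq_sum_range]

/-- The maximum removes l = 0, which occurs only for j = 0; a zero term in its place keeps all inner
sums of the same shape. -/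
theorem sum_Icc_max_eq_sum_range {M : Type*} [AddCommMonoid M] {n : ℕ} (hn : 1 ≤ n) (j : ℕ)
    (T : ℕ → M) :
    ∑ l ∈ Finset.Icc (max j 1) (n - 1), T l
      = ∑ i ∈ Finset.range (n - j), if j + i = 0 then 0 else T (j + i) := by
  rw [← sum_Icc_eq_sum_range hn j (fun l => if l = 0 then 0 else T l)]
  simp only [← ite_not (_ = 0)]
  rw [← Finset.sum_filter]
  refine Finset.sum_congr ?_ fun _ _ => rfl
  ext l
  simp only [Finset.mem_Icc, Finset.mem_filter]
  omega

/-- Closed form of the solution `w` in terms of `f` and its iterated derivatives `∂ʲf/∂z̄ʲ`. -/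
noncomputable def schwarzClosedForm (n : ℕ) (h f : ℂ → ℂ) (c : ℝ) (z : ℂ) : ℂ :=
  h z + Complex.I * (c - (h 0).im : ℝ)
    - ∑ j ∈ Finset.range n,
        ((-1) ^ (j + 1) / ((j + 1).factorial : ℂ) * star z ^ (j + 1)) * dbar^[j] f z

section Problem

variable {n : ℕ} {f : ℂ → ℂ}

/-- Each ∂/∂z̄ costs one derivative, so at least one of the n remains when k < n. -/
theorem dbar_iterate_contDiffOn_one (hf : ContDiffOn ℝ n f unitDisk) {k : ℕ} (hk : k < n) :
    ContDiffOn ℝ 1 (dbar^[k] f) unitDisk := by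
  have h := contDiffOn_dbar_iterate (m := 1) k (hf.of_le (by exact_mod_cast (by omega : 1 + k ≤ n)))
  exact_mod_cast h

theorem dbar_iterate_contDiffOn (hf : ContDiffOn ℝ n f unitDisk)
    (hf_eq : ∀ z ∈ unitDisk, dbar^[n] f z = 0) {k : ℕ} (hk : k < n) :
    ContDiffOn ℝ ∞ (dbar^[k] f) unitDisk :=
  contDiffOn_of_dbar_chain (F := fun j => dbar^[j] f)
    (fun _ hj => dbar_iterate_contDiffOn_one hf hj)
    (fun j _ z _ => (congrFun (Function.iterate_succ_apply' dbar j f) z).symm) hf_eq k hk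

/-- The representation applied to the chain that starts at the k-th derivative and has length n - k.
-/
theorem dbar_iterate_eq (hf : ContDiffOn ℝ n f unitDisk)
    (hf_eq : ∀ z ∈ unitDisk, dbar^[n] f z = 0)
    (hf_bv : ∀ k, k ≤ n - 1 → HasBoundaryValue (dbar^[k] f)) {k : ℕ} (hk : k < n)
    {z : ℂ} (hz : z ∈ unitDisk) :
    dbar^[k] f z = Complex.I * ∑ j ∈ Finset.range (n - k),
        ((dbar^[k + j] f 0).im : ℂ) / (j.factorial : ℂ) * (z + star z) ^ j
      + ∑ j ∈ Finset.range (n - k), (-1) ^ j / (2 * Real.pi * j.factorial : ℂ)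
        * pairing (reDist (boundaryValue (dbar^[k + j] f))) (kernelPQ z j) := by
  refine schwarz_representation (F := fun j => dbar^[k + j] f) (by omega)
    (fun j hj => dbar_iterate_contDiffOn_one hf (by omega))
    (fun j _ z _ => (congrFun (Function.iterate_succ_apply' dbar (k + j) f) z).symm)
    (fun z hz => ?_) (fun j hj => hf_bv _ (by omega)) hz
  simp only [Nat.add_sub_cancel' hk.le]
  exact hf_eq z hz

/-- Insert the representation of each derivative of f into the closed form and reindex by k = j + 1,
l = j + i. The pair j = i = 0 carries Re f_b = Re (h₀)_b and produces the separate `poissonPart h₀`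
term. -/
theorem schwarzSolution_eq (hn : 1 ≤ n) {H : ℕ → CircleDistribution} {h₀ : ℂ → ℂ}
    (hh₀ : h₀ ∈ Hb) {cs : ℕ → ℝ} (hf : ContDiffOn ℝ n f unitDisk)
    (hf_eq : ∀ z ∈ unitDisk, dbar^[n] f z = 0)
    (hf_bv : ∀ k, k ≤ n - 1 → HasBoundaryValue (dbar^[k] f))
    (hf_re : ∀ k, 1 ≤ k → k ≤ n - 1 → reDist (boundaryValue (dbar^[k] f)) = H k)
    (hf_re₀ : reDist (boundaryValue f) = reDist (boundaryValue h₀))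
    (hf_im : ∀ k, k ≤ n - 1 → (dbar^[k] f 0).im = cs k)
    {h : ℂ → ℂ} (hh : h ∈ Hb) (c : ℝ) :
    EqOn (schwarzSolution n h h₀ H c cs) (schwarzClosedForm n h f c) unitDisk := by
  intro z hz
  have hpi : (Real.pi : ℂ) ≠ 0 := by exact_mod_cast Real.pi_ne_zero
  have key : ∀ j ∈ Finset.range n, dbar^[j] f z
      = Complex.I * ∑ i ∈ Finset.range (n - j), (cs (j + i) : ℂ) / (i.factorial : ℂ)
          * (z + star z) ^ i
        + (∑ i ∈ Finset.range (n - j), if j + i = 0 then 0 else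
            (-1) ^ i / (2 * Real.pi * i.factorial : ℂ) * pairing (H (j + i)) (kernelPQ z i))
        + if j = 0 then poissonPart h₀ z else 0 := by
    intro j hj
    have hj := Finset.mem_range.1 hj
    rw [dbar_iterate_eq hf hf_eq hf_bv hj hz, add_assoc]
    congr 1
    · congr 1
      refine Finset.sum_congr rfl fun i hi => ?_
      have hi := Finset.mem_range.1 hi
      rw [hf_im _ (by omega)]
    · rcases Nat.eq_zero_or_pos j with rfl | hj0
      · obtain ⟨m, rfl⟩ : ∃ m, n = m + 1 := ⟨n - 1, by omega⟩
        rw [Nat.sub_zero, Finset.sum_range_succ', Finset.sum_range_succ', if_pos rfl, if_pos rfl]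
        refine congrArg₂ (· + ·)
          ((Finset.sum_congr rfl fun i hi => ?_).trans (add_zero _).symm) ?_
        · have hi := Finset.mem_range.1 hi
          rw [if_neg (by omega), hf_re _ (by omega) (by omega)]
        -- For j = i = 0 the kernel is the Schwarz kernel itself, and the Schwarz formula for h₀
        -- gives h₀ - i Im h₀(0), which is its Poisson part.
        · change (-1) ^ 0 / (2 * Real.pi * (Nat.factorial 0) : ℂ) *
            pairing (reDist (boundaryValue f)) (schwarzKernel z hz : ℝ → ℂ) = _
          rw [hf_re₀, pairing_coe, hh₀.2.isBoundaryValue.reDist_schwarzKernel hh₀.1,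
            poissonPart_eq hh₀ hz]
          simp only [pow_zero, Nat.factorial_zero, Nat.cast_one]
          field_simp
      · rw [if_neg (by omega), add_zero]
        refine Finset.sum_congr rfl fun i hi => ?_
        have hi := Finset.mem_range.1 hi
        rw [if_neg (by omega), hf_re _ (by omega) (by omega)]
  have e1 : Complex.I * ∑ k ∈ Finset.Icc 1 n, ∑ l ∈ Finset.Icc (k - 1) (n - 1),
        (-1) ^ k * (cs l : ℂ) / (k.factorial * (l - (k - 1)).factorial)
          * star z ^ k * (z + star z) ^ (l - (k - 1))
      = ∑ j ∈ Finset.range n, (-1) ^ (j + 1) / ((j + 1).factorial : ℂ) * star z ^ (j + 1) *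
        (Complex.I * ∑ i ∈ Finset.range (n - j), (cs (j + i) : ℂ) / (i.factorial : ℂ)
          * (z + star z) ^ i) := by
    rw [sum_Icc_one_eq_sum_range, Finset.mul_sum]
    refine Finset.sum_congr rfl fun j _ => ?_
    rw [Nat.add_sub_cancel, sum_Icc_eq_sum_range hn]
    simp only [Finset.mul_sum]
    refine Finset.sum_congr rfl fun i _ => ?_
    rw [Nat.add_sub_cancel_left]
    simp only [div_eq_mul_inv, mul_inv]
    ring
  have e2 : ∑ k ∈ Finset.Icc 1 n, ∑ l ∈ Finset.Icc (max (k - 1) 1) (n - 1),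
        (-1) ^ (l + 1) / (2 * Real.pi * k.factorial * (l - (k - 1)).factorial)
          * star z ^ k * pairing (H l) (kernelPQ z (l - (k - 1)))
      = ∑ j ∈ Finset.range n, (-1) ^ (j + 1) / ((j + 1).factorial : ℂ) * star z ^ (j + 1) *
        (∑ i ∈ Finset.range (n - j), if j + i = 0 then 0 else
            (-1) ^ i / (2 * Real.pi * i.factorial : ℂ) * pairing (H (j + i)) (kernelPQ z i)) := by
    rw [sum_Icc_one_eq_sum_range]
    refine Finset.sum_congr rfl fun j _ => ?_
    rw [Nat.add_sub_cancel, sum_Icc_max_eq_sum_range hn, Finset.mul_sum]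
    refine Finset.sum_congr rfl fun i _ => ?_
    split_ifs
    · simp
    rw [Nat.add_sub_cancel_left]
    simp only [div_eq_mul_inv, mul_inv]
    ring
  have e3 : ∑ j ∈ Finset.range n, (-1) ^ (j + 1) / ((j + 1).factorial : ℂ) * star z ^ (j + 1) *
      (if j = 0 then poissonPart h₀ z else 0) = -(star z * poissonPart h₀ z) := by
    rw [Finset.sum_eq_single_of_mem 0 (Finset.mem_range.2 hn)
      fun j _ hj => by rw [if_neg hj, mul_zero]]
    simp
  have e4 : ∑ j ∈ Finset.range n, (-1) ^ (j + 1) / ((j + 1).factorial : ℂ) * star z ^ (j + 1) *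
      dbar^[j] f z = _ := Finset.sum_congr rfl fun j hj => congrArg _ (key j hj)
  rw [schwarzSolution, e1, e2, schwarzClosedForm, poissonPart_eq hh hz, e4]
  simp only [mul_add, Finset.sum_add_distrib]
  rw [e3]
  push_cast
  ring

theorem contDiffOn_schwarzClosedForm (hf : ∀ k < n, ContDiffOn ℝ ∞ (dbar^[k] f) unitDisk)
    {h : ℂ → ℂ} (hh : DifferentiableOn ℂ h unitDisk) (c : ℝ) :
    ContDiffOn ℝ ∞ (schwarzClosedForm n h f c) unitDisk := by
  refine ContDiffOn.sub (ContDiffOn.add ?_ contDiffOn_const) (ContDiffOn.sum fun j hj => ?_)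
  · exact (hh.contDiffOn isOpen_unitDisk).restrict_scalars ℝ
  · exact (contDiffOn_const.mul (contDiff_star.pow _).contDiffOn).mul (hf j (Finset.mem_range.1 hj))

/-- The coefficients (-1)^j/j! z̄^j again form a chain under -∂/∂z̄; the sum has derivative a_n F_n
- a_0 F_0 = -f, and it enters with a minus sign. -/
theorem dbar_schwarzClosedForm (hf : ∀ k < n, ContDiffOn ℝ ∞ (dbar^[k] f) unitDisk)
    (hf_eq : ∀ z ∈ unitDisk, dbar^[n] f z = 0) {h : ℂ → ℂ} (hh : DifferentiableOn ℂ h unitDisk)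
    (c : ℝ) {z : ℂ} (hz : z ∈ unitDisk) : dbar (schwarzClosedForm n h f c) z = f z := by
  have hstar : DifferentiableAt ℝ (fun x : ℂ => star x) z :=
    (contDiff_star (m := 1)).differentiable (by norm_num) z
  have hhz : DifferentiableAt ℂ (fun z => h z + Complex.I * (c - (h 0).im : ℝ)) z :=
    (hh.differentiableAt (isOpen_unitDisk.mem_nhds hz)).add_const _
  obtain ⟨h1, h2⟩ := dbar_sum_mul (a := fun j x => (-1) ^ j / (j.factorial : ℂ) * star x ^ j)
    (F := fun j => dbar^[j] f) (z := z) n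
    (fun j => (differentiableAt_const _).fun_mul (hstar.fun_pow j))
    (fun j => by
      rw [dbar_mul (differentiableAt_const _) (hstar.fun_pow _), dbar_const, dbar_pow hstar,
        dbar_star, Nat.factorial_succ]
      have h1 : (j.factorial : ℂ) ≠ 0 := by exact_mod_cast j.factorial_ne_zero
      have h2 : (j : ℂ) + 1 ≠ 0 := by exact_mod_cast j.succ_ne_zero
      push_cast
      field_simp
      ring)
    (fun j hj => ((hf j hj).differentiableOn (by simp)).differentiableAt
      (isOpen_unitDisk.mem_nhds hz))
    (fun j _ => (congrFun (Function.iterate_succ_apply' dbar j f) z).symm)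
  unfold schwarzClosedForm
  rw [dbar_sub (hhz.restrictScalars ℝ) h1, dbar_of_differentiableAt hhz, h2, hf_eq z hz]
  simp

theorem isBoundaryValue_schwarzClosedForm
    (hf : ∀ k < n, ContDiffOn ℝ ∞ (dbar^[k] f) unitDisk)
    (hf_bv : ∀ k < n, HasBoundaryValue (dbar^[k] f)) {h : ℂ → ℂ} (hh : h ∈ Hb) (c : ℝ) :
    IsBoundaryValue (schwarzClosedForm n h f c)
      ((boundaryValue h - ∑ k ∈ Finset.Icc 1 n, ((-1) ^ k / (k.factorial : ℂ)) •
          mulDist (expTest k) (boundaryValue (dbar^[k - 1] f)))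
        + (Complex.I * (c - (h 0).im : ℝ) : ℂ) • circleMeasureDist) := by
  have hstar : ContinuousOn (fun x : ℂ => star x) unitDisk := by fun_prop
  have hc : ∀ j ∈ Finset.range n, ContinuousOn (fun z => (-1) ^ (j + 1) / ((j + 1).factorial : ℂ) *
      (star z ^ (j + 1) * dbar^[j] f z)) unitDisk := fun j hj =>
    continuousOn_const.mul ((hstar.pow _).mul (hf j (Finset.mem_range.1 hj)).continuousOn)
  have h1 := IsBoundaryValue.sum hc fun j hj =>
    ((hf_bv j (Finset.mem_range.1 hj)).isBoundaryValue.star_pow_mul (j + 1)).const_mul _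
  have hsum : ContinuousOn (fun z => -1 * ∑ j ∈ Finset.range n,
      (-1) ^ (j + 1) / ((j + 1).factorial : ℂ) * (star z ^ (j + 1) * dbar^[j] f z)) unitDisk :=
    continuousOn_const.mul (continuousOn_finsetSum _ hc)
  have h2 := (hh.2.isBoundaryValue.add hh.1.continuousOn hsum (h1.const_mul (-1))).add
    (hh.1.continuousOn.add hsum) continuousOn_const
    (isBoundaryValue_const (Complex.I * (c - (h 0).im : ℝ)))
  have hneg : ∀ v : CircleDistribution, (-1 : ℂ) • v = -v := fun v => neg_one_smul ℂ v
  rw [hneg, ← sub_eq_add_neg] at h2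
  rw [sum_Icc_one_eq_sum_range]
  refine h2.congr fun z _ => ?_
  simp only [schwarzClosedForm, mul_assoc, Pi.add_apply]
  ring

end Problem

end SchwarzDisk

/-! ### Verification of the boundary value problem of order n + 1 -/

open SchwarzDisk in
theorem mainTheorem5 (n : ℕ) (hn : 1 ≤ n)
    -- data of the problem for `f`
    (p : ℕ → ℝ) (hp : ∀ k, 1 ≤ k → k ≤ n - 1 → 1 / 2 < p k ∧ p k ≤ 1)
    (H : ℕ → SchwarzDisk.CircleDistribution)
    (hH : ∀ k, 1 ≤ k → k ≤ n - 1 → H k ∈ SchwarzDisk.ReHardyBoundary (p k))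
    (h₀ : ℂ → ℂ) (hh₀ : h₀ ∈ SchwarzDisk.Hb) (cs : ℕ → ℝ)
    -- `f` solves the problem of order `n`
    (f : ℂ → ℂ) (hf : ContDiffOn ℝ n f SchwarzDisk.unitDisk)
    (hf_eq : ∀ z ∈ SchwarzDisk.unitDisk, SchwarzDisk.dbar^[n] f z = 0)
    (hf_bv : ∀ k, k ≤ n - 1 → SchwarzDisk.HasBoundaryValue (SchwarzDisk.dbar^[k] f))
    (hf_re : ∀ k, 1 ≤ k → k ≤ n - 1 →
      SchwarzDisk.reDist (SchwarzDisk.boundaryValue (SchwarzDisk.dbar^[k] f)) = H k)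
    (hf_re₀ : SchwarzDisk.reDist (SchwarzDisk.boundaryValue f)
      = SchwarzDisk.reDist (SchwarzDisk.boundaryValue h₀))
    (hf_im : ∀ k, k ≤ n - 1 → (SchwarzDisk.dbar^[k] f 0).im = cs k)
    -- data of the problem for `w`
    (h : ℂ → ℂ) (hh : h ∈ SchwarzDisk.Hb) (c : ℝ)
    (w : ℂ → ℂ) (hw : w = SchwarzDisk.schwarzSolution n h h₀ H c cs) :
    ContDiffOn ℝ ∞ w SchwarzDisk.unitDisk ∧
    (∀ z ∈ SchwarzDisk.unitDisk, SchwarzDisk.dbar w z = f z) ∧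
    (∀ z ∈ SchwarzDisk.unitDisk, SchwarzDisk.dbar^[n + 1] w z = 0) ∧
    (∀ k, k ≤ n → SchwarzDisk.HasBoundaryValue (SchwarzDisk.dbar^[k] w)) ∧
    (∀ k, 1 ≤ k → k ≤ n - 1 →
      SchwarzDisk.reDist (SchwarzDisk.boundaryValue (SchwarzDisk.dbar^[k + 1] w)) = H k) ∧
    SchwarzDisk.reDist (SchwarzDisk.boundaryValue (SchwarzDisk.dbar w))
      = SchwarzDisk.reDist (SchwarzDisk.boundaryValue h₀) ∧
    SchwarzDisk.reDist (SchwarzDisk.boundaryValue w)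
      = SchwarzDisk.reDist (SchwarzDisk.boundaryValue h
        - ∑ k ∈ Finset.Icc 1 n, ((-1) ^ k / (k.factorial : ℂ)) •
            SchwarzDisk.mulDist (SchwarzDisk.expTest k)
              (SchwarzDisk.boundaryValue (SchwarzDisk.dbar^[k - 1] f))) ∧
    (∀ k, k ≤ n - 1 → (SchwarzDisk.dbar^[k + 1] w 0).im = cs k) ∧
    (w 0).im = c := by
  subst hw
  have hfs : ∀ k < n, ContDiffOn ℝ ∞ (dbar^[k] f) unitDisk :=
    fun k hk => dbar_iterate_contDiffOn hf hf_eq hk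
  have hw := schwarzSolution_eq hn hh₀ hf hf_eq hf_bv hf_re hf_re₀ hf_im hh c
  have hd : EqOn (dbar (schwarzSolution n h h₀ H c cs)) f unitDisk := fun z hz =>
    (dbar_congr hw hz).trans (dbar_schwarzClosedForm hfs hf_eq hh.1 c hz)
  -- Every condition on derivatives of w of order at least one now becomes the corresponding
  -- hypothesis on f.
  have hdk : ∀ k, EqOn (dbar^[k + 1] (schwarzSolution n h h₀ H c cs)) (dbar^[k] f) unitDisk := by
    intro k
    rw [Function.iterate_succ_apply]
    exact dbar_iterate_congr hd k
  have hbv := (isBoundaryValue_schwarzClosedForm hfs (fun k hk => hf_bv k (by omega)) hh c).congr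
    hw.symm
  have hbvk : ∀ k, k ≤ n - 1 →
      IsBoundaryValue (dbar^[k + 1] (schwarzSolution n h h₀ H c cs)) (boundaryValue (dbar^[k] f)) :=
    fun k hk => (hf_bv k hk).isBoundaryValue.congr (hdk k).symm
  refine ⟨(contDiffOn_schwarzClosedForm hfs hh.1 c).congr hw, hd,
    fun z hz => (hdk n hz).trans (hf_eq z hz), ?_, ?_, ?_, ?_, ?_, ?_⟩
  · rintro (_ | k) hk
    · exact ⟨_, hbv⟩
    · exact ⟨_, hbvk k (by omega)⟩
  · intro k h1 hk
    rw [(hbvk k hk).boundaryValue_eq, hf_re k h1 hk]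
  · rw [← hf_re₀]
    exact congrArg reDist (hbvk 0 (Nat.zero_le _)).boundaryValue_eq
  · rw [hbv.boundaryValue_eq, reDist_add, reDist_smul_I_circleMeasureDist, add_zero]
  · intro k hk
    rw [hdk k zero_mem_unitDisk, hf_im k hk]
  -- Every term of the sum has a positive power of z̄, so w(0) = h(0) + i(c - Im h(0)).
  · rw [hw zero_mem_unitDisk]
    simp [schwarzClosedForm]
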